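/- Let $m\ge 2$, let $\mathcal H$ and $\mathcal G$ be finite-dimensional real Hilbert spaces, and let $\boldsymbol{\mathcal H}=\mathcal H^m$ and $\boldsymbol{\mathcal H}\times\mathcal G$ carry their product Hilbert structures. For $\boldsymbol x\in\boldsymbol{\mathcal H}$, $z\in\mathcal H$, write $(z;\boldsymbol x_{\smallsetminus i})$ for $\boldsymbol x$ with its $i$-th component replaced by $z$, and let indices be cyclic ($x_0=x_m$). **Lower-level game.** Let $C_i\subset\mathcal H$ $(1\le i\le m)$ and $D\subset\mathcal G$ be closed convex sets, let $\boldsymbol L:\boldsymbol{\mathcal H}\to\mathcal G$ be linear, and put $\boldsymbol C=\prod_i C_i$. Assume that $\boldsymbol{\mathfrak C}=\{\boldsymbol x\in\boldsymbol C:\boldsymbol L\boldsymbol x\in D\}$ is nonempty. Let $\boldsymbol f_i:\boldsymbol{\mathcal H}\to\mathbb R$ be such that $\boldsymbol f_i(\cdot;\boldsymbol x_{\smallsetminus i})$ is convex and differentiable for all $i$ and $\boldsymbol x$. Put $\boldsymbol G(\boldsymbol x)=(\nabla_1\boldsymbol f_1(\boldsymbol x),\dots,\nabla_m\boldsymbol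 f_m(\boldsymbol x))$ and $$\boldsymbol{\mathcal V}=\{\boldsymbol v\in\boldsymbol{\mathfrak C}:\langle\boldsymbol G(\boldsymbol v),\boldsymbol w-\boldsymbol v\rangle\ge0\ \ \forall\boldsymbol w\in\boldsymbol{\mathfrak C}\}.$$ **Upper level.** Put $\mathfrak f_i(\boldsymbol x)=\tfrac12\|x_i-x_{i-1}\|^2$, $\boldsymbol{\mathfrak G}_{\rm cyc}(\boldsymbol x)=(\nabla_1\mathfrak f_1(\boldsymbol x),\dots,\nabla_m\mathfrak f_m(\boldsymbol x))$, and $$\boldsymbol{\mathcal V}^{\langle u\rangle}_{\rm cyc}=\{\boldsymbol x\in\boldsymbol{\mathcal V}:\langle\boldsymbol{\mathfrak G}_{\rm cyc}(\boldsymbol x),\boldsymbol y-\boldsymbol x\rangle\ge0\ \ \forall\boldsymbol y\in\boldsymbol{\mathcal V}\},$$ and assume $\boldsymbol{\mathcal V}^{\langle u\rangle}_{\rm cyc}\ne\varnothing$ (hence $\boldsymbol{\mathcal V}\neq\varnothing$). **Assumptions.** With $\iota$ denoting indicator functions ($0$ on the set, $+\infty$ off it): (a) $\partial(\iota_{\boldsymbol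 C}+\iota_D\circ\boldsymbol L)=\partial\iota_{\boldsymbol C}+\boldsymbol L^*\circ\partial\iota_D\circ\boldsymbol L$; (b) $\boldsymbol G$ is monotone and $\kappa$-Lipschitz on $\boldsymbol{\mathcal H}$, for some $\kappa>0$. **Algorithm.** For $\gamma\in(0,1/(\kappa+\|\boldsymbol L\|))$ and $\alpha\in(0,1)$ define, on $\boldsymbol{\mathcal H}\times\mathcal G$, $$\boldsymbol A(\boldsymbol x,u)=(\boldsymbol G(\boldsymbol x)+\boldsymbol L^*u,\,-\boldsymbol L\boldsymbol x),\qquad \boldsymbol B(\boldsymbol x,u)=\Bigl(\prod_i\partial\iota_{C_i}(x_i)\Bigr)\times\partial\iota_D^*(u),$$ $$\boldsymbol T_{\rm FBF}=(\mathrm{Id}-\gamma\boldsymbol A)\circ(\mathrm{Id}+\gamma\boldsymbol B)^{-1}\circ(\mathrm{Id}-\gamma\boldsymbol A)+\gamma\boldsymbol A,\qquad \boldsymbol T^\alpha_{\rm FBF}=(1-\alpha)\mathrm{Id}+\alpha\boldsymbol T_{\rm FBF},$$ where $\iota_D^*$ is the Legendre–Fenchel conjugate of $\iota_D$. Assume that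 $\mathrm{Fix}(\boldsymbol T^\alpha_{\rm FBF})$ is bounded and let $r>0$ be such that $\mathrm{Fix}(\boldsymbol T^\alpha_{\rm FBF})\subset\overline B(0;r)$. Let $\lambda_n\ge0$ satisfy $\lim_n\lambda_n=0$ and $\sum_n\lambda_n=\infty$, put $\widetilde{\boldsymbol{\mathfrak G}}(\boldsymbol x,u)=(\boldsymbol{\mathfrak G}_{\rm cyc}(\boldsymbol x),0)$ and $\boldsymbol S=P_{\overline B(0;r)}\circ\boldsymbol T^\alpha_{\rm FBF}$, where $P$ denotes metric projection. For an arbitrary $\boldsymbol\xi_0\in\boldsymbol{\mathcal H}\times\mathcal G$ let $$\boldsymbol\xi_{n+1}=\boldsymbol S(\boldsymbol\xi_n)-\lambda_{n+1}\widetilde{\boldsymbol{\mathfrak G}}(\boldsymbol S(\boldsymbol\xi_n)),\qquad \boldsymbol\xi_n=(\boldsymbol x_n,u_n).$$ **Conclusion.** $\lim_{n\to\infty}d\bigl(\boldsymbol x_n,\boldsymbol{\mathcal V}^{\langle u\rangle}_{\rm cyc}\bigr)=0$. Moreover every $\bar{\boldsymbol x}\in\boldsymbol{\mathcal V}^{\langle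 u\rangle}_{\rm cyc}$ is a cycle over $\boldsymbol{\mathcal V}$: $\bar{\boldsymbol x}\in\boldsymbol{\mathcal V}$ and $\bar x_i=P_{\mathcal V_i(\bar{\boldsymbol x}_{\smallsetminus i})}(\bar x_{i-1})$ for all $i$, where $\mathcal V_i(\boldsymbol x_{\smallsetminus i})=\{z\in\mathcal H:(z;\boldsymbol x_{\smallsetminus i})\in\boldsymbol{\mathcal V}\}$. -/

import Mathlib

open Set Filter Topology
open scoped Pointwise

namespace CycleSelection

noncomputable section

/-! ### Convex analysis -/

section ConvexAnalysis

variable {X : Type*} [NormedAddCommGroup X] [InnerProductSpace ℝ X]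

open Classical in
/-- The indicator function `ι_S` of convex analysis: `0` on `S` and `+∞` off `S`. -/
def indicatorFn (S : Set X) (x : X) : EReal := if x ∈ S then 0 else ⊤

/-- The Legendre-Fenchel conjugate `f*(u) = sup_x (⟨x, u⟩ - f x)`. -/
def conjugate (f : X → EReal) (u : X) : EReal := ⨆ x : X, ((inner ℝ x u : ℝ) : EReal) - f x

/-- The subdifferential `∂f(x) = {u | ⟨y - x, u⟩ + f x ≤ f y for all y}`. -/
def subdifferential (f : X → EReal) (x : X) : Set X :=
  {u | ∀ y : X, ((inner ℝ (y - x) u : ℝ) : EReal) + f x ≤ f y}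

/-- `y` is a point of `S` nearest to `x`. -/
def IsNearest (S : Set X) (x y : X) : Prop := y ∈ S ∧ ∀ z ∈ S, ‖x - y‖ ≤ ‖x - z‖

open Classical in
/-- The metric projection `P_S`. For a nonempty closed convex set `S` the nearest point exists and
is unique; the value is `x` by convention where no nearest point exists. -/
def metricProj (S : Set X) (x : X) : X := if h : ∃ y, IsNearest S x y then h.choose else x

open Classical in
/-- The resolvent `(Id + γ B)⁻¹` of a set-valued operator `B`, i.e. the solution `η` of
`ξ ∈ η + γ B η`. It exists and is unique when `B` is maximally monotone and `γ > 0`;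
the value is `ξ` by convention where there is no solution. -/
def resolvent (γ : ℝ) (B : X → Set X) (ξ : X) : X :=
  if h : ∃ η, ∃ b ∈ B η, ξ = η + γ • b then h.choose else ξ

/-- The solution set of the variational inequality `VI(S, F)`. -/
def solVI (S : Set X) (F : X → X) : Set X := {x | x ∈ S ∧ ∀ y ∈ S, 0 ≤ inner ℝ (F x) (y - x)}

end ConvexAnalysis

/-! ### Games in which every one of the `m` players has the same strategy space `E` -/

/-- The Hilbert space `E^m` of strategy profiles, with inner product `∑ i, ⟨x i, y i⟩`. -/
abbrev Profile (m : ℕ) (E : Type*) : Type _ := PiLp 2 (fun _ : Fin m => E)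

/-- The Hilbert space `E^m × G`, with the sum of the inner products. -/
abbrev PrimalDual (m : ℕ) (E G : Type*) : Type _ := WithLp 2 (Profile m E × G)

/-- The profile `(z; x_{∖i})`: the `i`-th strategy of `x` is replaced by `z`. -/
def replaceAt {m : ℕ} {E : Type*} (x : Profile m E) (i : Fin m) (z : E) : Profile m E :=
  WithLp.toLp 2 (Function.update (fun j => x j) i z)

section Games

variable {m : ℕ} {E : Type*} [NormedAddCommGroup E] [InnerProductSpace ℝ E]
variable {G : Type*} [NormedAddCommGroup G] [InnerProductSpace ℝ G]

/-- The map `x ↦ (∇₁ f₁(x), …, ∇ₘ fₘ(x))`, where `∇ᵢ fᵢ(x)` is the gradient of `fᵢ(·; x_{∖i})`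
at `x i`. -/
def pseudoGradient [CompleteSpace E] (f : Fin m → Profile m E → ℝ) (x : Profile m E) :
    Profile m E :=
  WithLp.toLp 2 (fun i => gradient (fun z : E => f i (replaceAt x i z)) (x i))

variable (m E G) in
/-- The data of a generalized Nash equilibrium problem: player `i` minimizes
`cost i (·; x_{∖i})` over `C i`, subject to the shared constraint `L x ∈ D`. -/
structure GNEP where
  cost : Fin m → Profile m E → ℝ
  C : Fin m → Set E
  L : Profile m E →L[ℝ] G
  D : Set G
  cost_convex : ∀ i x, ConvexOn ℝ Set.univ (fun z : E => cost i (replaceAt x i z))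
  cost_differentiable : ∀ i x, Differentiable ℝ (fun z : E => cost i (replaceAt x i z))
  C_closed : ∀ i, IsClosed (C i)
  C_convex : ∀ i, Convex ℝ (C i)
  D_closed : IsClosed D
  D_convex : Convex ℝ D
  feasible_nonempty : ∃ x : Profile m E, (∀ i, x i ∈ C i) ∧ L x ∈ D

namespace GNEP

variable (P : GNEP m E G)

/-- The Cartesian product of the sets `C i`. -/
def prodC : Set (Profile m E) := {x | ∀ i, x i ∈ P.C i}

/-- The set of all feasible profiles. -/
def feasible : Set (Profile m E) := P.prodC ∩ P.L ⁻¹' P.D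

/-- `B (x, u) = (∏ i, ∂ι_{C i}(x i)) × ∂(ι_D)*(u)`. -/
def opB (ξ : PrimalDual m E G) : Set (PrimalDual m E G) :=
  {η | (∀ i, η.fst i ∈ subdifferential (indicatorFn (P.C i)) (ξ.fst i)) ∧
    η.snd ∈ subdifferential (conjugate (indicatorFn P.D)) ξ.snd}

variable [CompleteSpace E]

/-- The pseudo-gradient of the costs of the game. -/
def grad : Profile m E → Profile m E := pseudoGradient P.cost

/-- The set of variational generalized Nash equilibria (v-GNE) of the game. -/
def vGNE : Set (Profile m E) := solVI P.feasible P.grad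

variable [CompleteSpace G]

/-- `∂(ι_C + ι_D ∘ L) = ∂ι_C + L* ∘ ∂ι_D ∘ L`, where `C` is the product of the `C i`. -/
def SubdifferentialRule : Prop :=
  ∀ x : Profile m E,
    subdifferential (fun y => indicatorFn P.prodC y + indicatorFn P.D (P.L y)) x =
      subdifferential (indicatorFn P.prodC) x +
        (ContinuousLinearMap.adjoint P.L) '' subdifferential (indicatorFn P.D) (P.L x)

/-- `A (x, u) = (grad x + L* u, - L x)`. -/
def opA (ξ : PrimalDual m E G) : PrimalDual m E G :=
  WithLp.toLp 2 (P.grad ξ.fst + ContinuousLinearMap.adjoint P.L ξ.snd, - P.L ξ.fst)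

/-- The forward-backward operator `(Id + γ B)⁻¹ ∘ (Id - γ A)`. -/
def opFB (γ : ℝ) (ξ : PrimalDual m E G) : PrimalDual m E G :=
  resolvent γ P.opB (ξ - γ • P.opA ξ)

/-- The forward-backward-forward operator `(Id - γ A) ∘ (Id + γ B)⁻¹ ∘ (Id - γ A) + γ A`. -/
def opFBF (γ : ℝ) (ξ : PrimalDual m E G) : PrimalDual m E G :=
  (P.opFB γ ξ - γ • P.opA (P.opFB γ ξ)) + γ • P.opA ξ

/-- The averaged operator `(1 - α) Id + α T_FBF`. -/
def opFBFavg (γ α : ℝ) (ξ : PrimalDual m E G) : PrimalDual m E G :=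
  (1 - α) • ξ + α • P.opFBF γ ξ

end GNEP

/-! ### Cycles -/

/-- The upper-level costs `½ ‖x i - x (i - 1)‖²`; subtraction in `Fin m` is cyclic, so the
predecessor of the first player is the last one. -/
def cycleCost [NeZero m] (i : Fin m) (x : Profile m E) : ℝ := (1 / 2) * ‖x i - x (i - 1)‖ ^ 2

/-- The pseudo-gradient of the upper-level costs. -/
def cycleGrad [NeZero m] [CompleteSpace E] : Profile m E → Profile m E :=
  pseudoGradient cycleCost

/-- `(x, u) ↦ (cycleGrad x, 0)` on `E^m × G`. -/
def cycleGradExt [NeZero m] [CompleteSpace E] (ξ : PrimalDual m E G) : PrimalDual m E G :=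
  WithLp.toLp 2 (cycleGrad ξ.fst, 0)

/-- The solution set of the upper-level v-GNEP over `V` with the costs `cycleCost`. -/
def upperCycleVGNE [NeZero m] [CompleteSpace E] (V : Set (Profile m E)) : Set (Profile m E) :=
  solVI V cycleGrad

/-- The slice `V_i(x_{∖i}) = {z | (z; x_{∖i}) ∈ V}`. -/
def slice (V : Set (Profile m E)) (i : Fin m) (x : Profile m E) : Set E :=
  {z | replaceAt x i z ∈ V}

/-- The cycles over `V`: profiles `x ∈ V` such that each `x i` is the projection of the
predecessor's strategy `x (i - 1)` onto the slice `V_i(x_{∖i})`. -/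
def cyclesOver [NeZero m] (V : Set (Profile m E)) : Set (Profile m E) :=
  {x | x ∈ V ∧ ∀ i, x i = metricProj (slice V i x) (x (i - 1))}

end Games

end

end CycleSelection

/-! Fixed points of `opFBFavg` are exactly the zeros of `A + B`, that is, the primal-dual solutions
of the lower-level game, and the subdifferential rule makes their primal parts fill out `vGNE`
(`fst_mem_vGNE`, `exists_multiplier`). Since `cycleGradExt` ignores the dual variable, the
upper-level inequality over `vGNE` lifts to one over the fixed-point set `F`, and the iteration is
hybrid steepest descent for it.

Two facts drive convergence. Tseng's estimate (`norm_fbf_sub_sq_le`) with `γ (κ + ‖L‖) < 1` brings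
every non-fixed point strictly closer to every point of `F`, and projecting onto a ball containing
`F` preserves this while making the range bounded. Moreover `cycleGrad` is the identity minus a
cyclic shift, an isometry, hence is 1/2-cocoercive.

`tendsto_infDist_solVI` combines them by compactness: vanishing perturbations force the distance to
`F` to zero, and near `F` but away from the solutions the descent direction gains a fixed multiple
of `lam (n + 1)`, which cannot continue because `∑ lam` diverges. Cycles come from testing the
inequality against deviations of a single player. -/

namespace CycleSelection

/-! ### Projections, normal cones and support functions. -/

section ConvexAnalysis

variable {X : Type*} [NormedAddCommGroup X] [InnerProductSpace ℝ X]

/-- The inequality gives `‖x - y‖² + ‖z - y‖² ≤ ‖x - z‖²`, so `y` is the only nearest point and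
`choose` must return it. No convexity is required, so this applies directly to slices. -/
lemma metricProj_eq_of_inner_nonneg {S : Set X} {x y : X} (hy : y ∈ S)
    (h : ∀ z ∈ S, 0 ≤ inner ℝ (y - x) (z - y)) : metricProj S x = y := by
  have key : ∀ z ∈ S, ‖x - y‖ ^ 2 + ‖z - y‖ ^ 2 ≤ ‖x - z‖ ^ 2 := by
    intro z hz
    have e : x - z = -((y - x) + (z - y)) := by abel
    rw [e, norm_neg, norm_add_sq_real, norm_sub_rev x y]
    linarith [h z hz]
  have hex : ∃ y, IsNearest S x y := by
    refine ⟨y, hy, fun z hz => ?_⟩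
    refine le_of_sq_le_sq ?_ (norm_nonneg _)
    nlinarith [key z hz, sq_nonneg ‖z - y‖]
  unfold metricProj
  rw [dif_pos hex]
  have hc := hex.choose_spec
  have h1 := hc.2 y hy
  have h2 := key _ hc.1
  have h3 : ‖x - hex.choose‖ ^ 2 ≤ ‖x - y‖ ^ 2 := by gcongr
  have h4 : ‖hex.choose - y‖ ^ 2 ≤ 0 := by linarith
  have h5 : ‖hex.choose - y‖ = 0 :=
    pow_eq_zero_iff two_ne_zero |>.1 (le_antisymm h4 (sq_nonneg _))
  exact sub_eq_zero.1 (norm_eq_zero.1 h5)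

lemma exists_mem_forall_inner_nonneg [CompleteSpace X] {S : Set X} (hne : S.Nonempty)
    (hcl : IsClosed S) (hcv : Convex ℝ S) (x : X) :
    ∃ y ∈ S, ∀ z ∈ S, 0 ≤ inner ℝ (y - x) (z - y) := by
  obtain ⟨y, hy, h⟩ := exists_norm_eq_iInf_of_complete_convex hne hcl.isComplete hcv x
  refine ⟨y, hy, fun z hz => ?_⟩
  have := (norm_eq_iInf_iff_real_inner_le_zero hcv hy).1 h z hz
  rw [← neg_sub x y, inner_neg_left]
  linarith

lemma metricProj_spec [CompleteSpace X] {S : Set X} (hne : S.Nonempty)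
    (hcl : IsClosed S) (hcv : Convex ℝ S) (x : X) :
    metricProj S x ∈ S ∧ ∀ z ∈ S, 0 ≤ inner ℝ (metricProj S x - x) (z - metricProj S x) := by
  obtain ⟨y, hy, h⟩ := exists_mem_forall_inner_nonneg hne hcl hcv x
  rw [metricProj_eq_of_inner_nonneg hy h]
  exact ⟨hy, h⟩

lemma metricProj_of_mem {S : Set X} {x : X} (hx : x ∈ S) : metricProj S x = x :=
  metricProj_eq_of_inner_nonneg hx (by simp)

lemma norm_le_of_norm_sq_le_inner {a b : X} (h : ‖a‖ ^ 2 ≤ inner ℝ a b) : ‖a‖ ≤ ‖b‖ := by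
  have h1 := real_inner_le_norm a b
  by_contra! hlt
  have : 0 < ‖a‖ := (norm_nonneg b).trans_lt hlt
  nlinarith

lemma norm_metricProj_sub_metricProj_le [CompleteSpace X] {S : Set X} (hne : S.Nonempty)
    (hcl : IsClosed S) (hcv : Convex ℝ S) (x y : X) :
    ‖metricProj S x - metricProj S y‖ ≤ ‖x - y‖ := by
  obtain ⟨hx, hx'⟩ := metricProj_spec hne hcl hcv x
  obtain ⟨hy, hy'⟩ := metricProj_spec hne hcl hcv y
  have h1 := hx' _ hy
  have h2 := hy' _ hx
  refine norm_le_of_norm_sq_le_inner ?_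
  rw [← real_inner_self_eq_norm_sq]
  simp only [inner_sub_left, inner_sub_right] at h1 h2 ⊢
  simp only [real_inner_comm] at h1 h2 ⊢
  linarith [real_inner_comm x (metricProj S x), real_inner_comm x (metricProj S y),
    real_inner_comm y (metricProj S x), real_inner_comm y (metricProj S y),
    real_inner_comm (metricProj S x) (metricProj S y)]

lemma continuous_metricProj [CompleteSpace X] {S : Set X} (hne : S.Nonempty)
    (hcl : IsClosed S) (hcv : Convex ℝ S) : Continuous (metricProj S) :=
  (LipschitzWith.of_dist_le_mul (K := 1) fun x y => by
    simpa [dist_eq_norm] using norm_metricProj_sub_metricProj_le hne hcl hcv x y).continuous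

/-- Nonemptiness matters: for empty `S` the function is constantly `⊤` and every vector is a
subgradient. -/
lemma mem_subdifferential_indicatorFn {S : Set X} (hne : S.Nonempty) {x u : X} :
    u ∈ subdifferential (indicatorFn S) x ↔ x ∈ S ∧ ∀ y ∈ S, inner ℝ (y - x) u ≤ 0 := by
  constructor
  · intro h
    have hx : x ∈ S := by
      by_contra hx
      obtain ⟨y, hy⟩ := hne
      simpa [indicatorFn, hx, hy] using h y
    refine ⟨hx, fun y hy => ?_⟩
    have := h y
    simp only [indicatorFn, hx, hy, if_true, add_zero] at this
    exact_mod_cast this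
  · rintro ⟨hx, h⟩ y
    by_cases hy : y ∈ S
    · simp only [indicatorFn, hx, hy, if_true, add_zero]
      exact_mod_cast h y hy
    · simp [indicatorFn, hy]

lemma conjugate_indicatorFn_le_iff {S : Set X} {u : X} {c : EReal} :
    conjugate (indicatorFn S) u ≤ c ↔ ∀ x ∈ S, ((inner ℝ x u : ℝ) : EReal) ≤ c := by
  unfold conjugate
  rw [iSup_le_iff]
  refine forall_congr' fun x => ?_
  by_cases hx : x ∈ S <;> simp [indicatorFn, hx]

lemma inner_le_conjugate_indicatorFn {S : Set X} {x : X} (hx : x ∈ S) (u : X) :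
    ((inner ℝ x u : ℝ) : EReal) ≤ conjugate (indicatorFn S) u :=
  conjugate_indicatorFn_le_iff.1 le_rfl x hx

/-- The subdifferential of the support function inverts the normal cone, so `w` lies in `S` and `u`
is normal to `S` at `w`. -/
lemma mem_subdifferential_conjugate_indicatorFn [CompleteSpace X] {S : Set X}
    (hne : S.Nonempty) (hcl : IsClosed S) (hcv : Convex ℝ S) {u w : X} :
    w ∈ subdifferential (conjugate (indicatorFn S)) u ↔
      w ∈ S ∧ ∀ y ∈ S, inner ℝ (y - w) u ≤ 0 := by
  constructor
  · intro h
    -- Finiteness: testing at `0`, where the support function is at most `0`, excludes `⊤`; a point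
    -- of `S` excludes `⊥`.
    obtain ⟨s, hs⟩ : ∃ s : ℝ, conjugate (indicatorFn S) u = s := by
      have h0 := h 0
      have h1 : conjugate (indicatorFn S) (0 : X) ≤ 0 :=
        conjugate_indicatorFn_le_iff.2 fun x _ => by simp
      have h2 := h0.trans h1
      induction hσ : conjugate (indicatorFn S) u with
      | bot =>
        obtain ⟨y, hy⟩ := hne
        have := inner_le_conjugate_indicatorFn hy u
        simp [hσ] at this
      | top => simp [hσ] at h2
      | coe s => exact ⟨s, rfl⟩
    have hle : ∀ y ∈ S, inner ℝ y u ≤ s := fun y hy => by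
      have := inner_le_conjugate_indicatorFn hy u
      rw [hs] at this
      exact_mod_cast this
    have hsub : ∀ (v : X) (c : ℝ), (∀ y ∈ S, inner ℝ y v ≤ c) → inner ℝ (v - u) w + s ≤ c := by
      intro v c hc
      have h1 := h v
      rw [hs] at h1
      have h2 : conjugate (indicatorFn S) v ≤ (c : EReal) :=
        conjugate_indicatorFn_le_iff.2 fun y hy => by exact_mod_cast hc y hy
      exact_mod_cast h1.trans h2
    have hsw : s ≤ inner ℝ w u := by
      have := hsub 0 0 (by simp)
      rw [zero_sub, inner_neg_left, real_inner_comm] at this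
      linarith
    refine ⟨?_, fun y hy => ?_⟩
    -- With `p` the projection of `w`, moving `u` in the separating direction `w - p` raises the
    -- support function by at most `⟨p, w - p⟩`; the subgradient inequality then gives `‖w - p‖² ≤
    -- 0`.
    · obtain ⟨p, hp, hp'⟩ := exists_mem_forall_inner_nonneg hne hcl hcv w
      have h1 := hsub (u + (w - p)) (s + inner ℝ p (w - p)) fun y hy => by
        have h2 := hp' y hy
        have h3 := hle y hy
        rw [← neg_sub w p, inner_neg_left, inner_sub_right, real_inner_comm y,
          real_inner_comm p] at h2
        rw [inner_add_right]
        linarith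
      have h4 : ‖w - p‖ ^ 2 ≤ 0 := by
        rw [← real_inner_self_eq_norm_sq]
        rw [add_sub_cancel_left, real_inner_comm] at h1
        rw [inner_sub_left]
        linarith
      have h5 : ‖w - p‖ = 0 := pow_eq_zero_iff two_ne_zero |>.1 (le_antisymm h4 (sq_nonneg _))
      rw [sub_eq_zero.1 (norm_eq_zero.1 h5)]
      exact hp
    · rw [inner_sub_left]
      linarith [hle y hy]
  · rintro ⟨hw, h⟩ v
    have h1 : conjugate (indicatorFn S) u ≤ ((inner ℝ w u : ℝ) : EReal) :=
      conjugate_indicatorFn_le_iff.2 fun y hy => by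
        have := h y hy
        rw [inner_sub_left] at this
        exact_mod_cast (by linarith : inner ℝ y u ≤ inner ℝ w u)
    calc ((inner ℝ (v - u) w : ℝ) : EReal) + conjugate (indicatorFn S) u
        ≤ ((inner ℝ (v - u) w : ℝ) : EReal) + ((inner ℝ w u : ℝ) : EReal) := by gcongr
      _ = ((inner ℝ w v : ℝ) : EReal) := by
        rw [← EReal.coe_add, inner_sub_left, real_inner_comm w u, real_inner_comm w v]
        congr 1
        ring
      _ ≤ _ := inner_le_conjugate_indicatorFn hw v

end ConvexAnalysis

/-! ### Resolvents and Tseng's forward-backward-forward estimate. -/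

section MonotoneOperators

variable {X : Type*} [NormedAddCommGroup X] [InnerProductSpace ℝ X]

/-- A set-valued operator `B` is monotone. -/
def IsMonotoneOp (B : X → Set X) : Prop :=
  ∀ x y, ∀ a ∈ B x, ∀ b ∈ B y, 0 ≤ inner ℝ (a - b) (x - y)

/-- The operator `Id + γ B` is surjective. -/
def HasFullRange (γ : ℝ) (B : X → Set X) : Prop :=
  ∀ ξ : X, ∃ η, ∃ b ∈ B η, ξ = η + γ • b

variable {γ : ℝ} {B : X → Set X}

lemma resolvent_spec (hB : HasFullRange γ B) (ξ : X) :
    ∃ b ∈ B (resolvent γ B ξ), ξ = resolvent γ B ξ + γ • b := by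
  unfold resolvent
  rw [dif_pos (hB ξ)]
  exact (hB ξ).choose_spec

lemma IsMonotoneOp.norm_sub_le (hB : IsMonotoneOp B) (hγ : 0 < γ) {x y a b : X}
    (ha : a ∈ B x) (hb : b ∈ B y) : ‖x - y‖ ≤ ‖(x + γ • a) - (y + γ • b)‖ := by
  refine norm_le_of_norm_sq_le_inner ?_
  have e : (x + γ • a) - (y + γ • b) = (x - y) + γ • (a - b) := by
    rw [smul_sub]; abel
  rw [e, inner_add_right, real_inner_self_eq_norm_sq, inner_smul_right, real_inner_comm]
  nlinarith [hB x y a ha b hb]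

lemma norm_resolvent_sub_le (hB : IsMonotoneOp B) (hr : HasFullRange γ B) (hγ : 0 < γ)
    (ξ ζ : X) : ‖resolvent γ B ξ - resolvent γ B ζ‖ ≤ ‖ξ - ζ‖ := by
  obtain ⟨a, ha, hξ⟩ := resolvent_spec hr ξ
  obtain ⟨b, hb, hζ⟩ := resolvent_spec hr ζ
  have := hB.norm_sub_le hγ ha hb
  rwa [← hξ, ← hζ] at this

lemma continuous_resolvent (hB : IsMonotoneOp B) (hr : HasFullRange γ B) (hγ : 0 < γ) :
    Continuous (resolvent γ B) :=
  (LipschitzWith.of_dist_le_mul (K := 1) fun x y => by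
    simpa [dist_eq_norm] using norm_resolvent_sub_le hB hr hγ x y).continuous

lemma resolvent_eq (hB : IsMonotoneOp B) (hr : HasFullRange γ B) (hγ : 0 < γ) {η b : X}
    (hb : b ∈ B η) : resolvent γ B (η + γ • b) = η := by
  obtain ⟨a, ha, h⟩ := resolvent_spec hr (η + γ • b)
  have := hB.norm_sub_le hγ ha hb
  rw [← h, sub_self, norm_zero] at this
  exact sub_eq_zero.1 (norm_le_zero_iff.1 this)

lemma resolvent_forward_eq_self_iff (hB : IsMonotoneOp B) (hr : HasFullRange γ B) (hγ : 0 < γ)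
    {ξ a : X} : resolvent γ B (ξ - γ • a) = ξ ↔ -a ∈ B ξ := by
  constructor
  · intro h
    obtain ⟨b, hb, hξ⟩ := resolvent_spec hr (ξ - γ • a)
    rw [h, sub_eq_add_neg, add_right_inj, ← smul_neg] at hξ
    rw [smul_right_injective X hγ.ne' hξ, ← h]
    rwa [h] at hb ⊢
  · intro h
    have := resolvent_eq hB hr hγ h
    rwa [smul_neg, ← sub_eq_add_neg] at this

/-- The key estimate for the forward-backward-forward operator. -/
lemma norm_fbf_sub_sq_le (hB : IsMonotoneOp B) (hr : HasFullRange γ B) (hγ : 0 < γ)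
    {A : X → X} (hA : ∀ x y, 0 ≤ inner ℝ (A x - A y) (x - y)) {ξ η z : X}
    (hη : η = resolvent γ B (ξ - γ • A ξ)) (hz : -A z ∈ B z) :
    ‖(η - γ • A η) + γ • A ξ - z‖ ^ 2 ≤
      ‖ξ - z‖ ^ 2 - ‖ξ - η‖ ^ 2 + ‖γ • (A ξ - A η)‖ ^ 2 := by
  obtain ⟨b, hb, h⟩ := resolvent_spec hr (ξ - γ • A ξ)
  rw [← hη] at hb h
  have h1 := hB _ _ _ hb _ hz
  have h2 := hA η z
  -- The sum of the two monotonicity inequalities between `η` and `z`. It is exactly the comparison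
  -- of cross terms when both squared norms are expanded around `η - z`.
  have h3 : 0 ≤ inner ℝ ((ξ - η) - γ • (A ξ - A η)) (η - z) := by
    have e : (ξ - η) - γ • (A ξ - A η) = γ • (b - -A z) + γ • (A η - A z) := by
      have : ξ = η + γ • b + γ • A ξ := by rw [← h]; abel
      calc (ξ - η) - γ • (A ξ - A η) = (η + γ • b + γ • A ξ - η) - γ • (A ξ - A η) := by
            rw [← this]
        _ = _ := by module
    rw [e, inner_add_left, real_inner_smul_left, real_inner_smul_left]
    positivity
  have e1 : (η - γ • A η) + γ • A ξ - z = (η - z) + γ • (A ξ - A η) := by module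
  have e2 : ξ - z = (η - z) + (ξ - η) := by abel
  rw [e1, e2, norm_add_sq_real, norm_add_sq_real]
  rw [inner_sub_left, real_inner_comm, real_inner_comm (η - z)] at h3
  linarith

end MonotoneOperators

/-! ### Hybrid steepest descent. -/

section HybridSteepestDescent

/-- While `a` stays above the threshold it loses `δ * lam (n + 1)` at each step, which divergence of
the sum forbids forever; once below, the maximum keeps it there. -/
lemma tendsto_zero_of_eventually_le_max_sub {a lam : ℕ → ℝ} (ha : ∀ n, 0 ≤ a n)
    (hlam : ∀ n, 0 ≤ lam n)
    (hsum : Tendsto (fun N => ∑ n ∈ Finset.range N, lam n) atTop atTop)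
    (h : ∀ ε > 0, ∃ δ > 0, ∀ᶠ n in atTop, a (n + 1) ≤ max ε (a n - δ * lam (n + 1))) :
    Tendsto a atTop (𝓝 0) := by
  rw [Metric.tendsto_atTop]
  intro ε hε
  obtain ⟨δ, hδ, hev⟩ := h (ε / 2) (half_pos hε)
  obtain ⟨N, hN⟩ := eventually_atTop.1 hev
  have hex : ∃ n ≥ N, a n ≤ ε / 2 := by
    by_contra! hcon
    have hdec : ∀ k, a (N + k) + δ * ∑ n ∈ Finset.range (N + k + 1), lam n ≤
        a N + δ * ∑ n ∈ Finset.range (N + 1), lam n := by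
      intro k
      induction k with
      | zero => simp
      | succ k ih =>
        have h1 := hN (N + k) (by omega)
        have h2 := hcon (N + k + 1) (by omega)
        rcases le_max_iff.1 h1 with h3 | h3
        · linarith
        · rw [← add_assoc, Finset.sum_range_succ]
          nlinarith
    obtain ⟨M, hM⟩ := (tendsto_atTop.1 hsum
      ((a N + δ * ∑ n ∈ Finset.range (N + 1), lam n) / δ + 1)).exists_forall_of_atTop
    have h1 := hM (N + M + 1) (by omega)
    have h2 := hdec M
    have h3 := ha (N + M)
    have h4 : δ * ((a N + δ * ∑ n ∈ Finset.range (N + 1), lam n) / δ + 1) ≤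
        δ * ∑ n ∈ Finset.range (N + M + 1), lam n := by gcongr
    rw [mul_add, mul_div_cancel₀ _ hδ.ne'] at h4
    linarith
  obtain ⟨n₀, hn₀, han₀⟩ := hex
  have hstay : ∀ k, a (n₀ + k) ≤ ε / 2 := by
    intro k
    induction k with
    | zero => exact han₀
    | succ k ih =>
      have h1 := hN (n₀ + k) (by omega)
      have h2 := mul_nonneg hδ.le (hlam (n₀ + k + 1))
      exact h1.trans (max_le le_rfl (by linarith))
  refine ⟨n₀, fun n hn => ?_⟩
  obtain ⟨k, rfl⟩ := Nat.exists_eq_add_of_le hn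
  rw [Real.dist_eq, sub_zero, abs_of_nonneg (ha _)]
  linarith [hstay k]

variable {X : Type*} [NormedAddCommGroup X]

lemma infDist_le_infDist_of_norm_le {F : Set X} (hF : IsCompact F) (hne : F.Nonempty) {x y : X}
    (h : ∀ z ∈ F, ‖y - z‖ ≤ ‖x - z‖) : Metric.infDist y F ≤ Metric.infDist x F := by
  obtain ⟨z, hz, hxz⟩ := hF.exists_infDist_eq_dist hne x
  rw [hxz, dist_eq_norm]
  exact (Metric.infDist_le_dist_of_mem hz).trans (by rw [dist_eq_norm]; exact h z hz)

lemma infDist_lt_infDist_of_norm_lt {F : Set X} (hF : IsCompact F) (hne : F.Nonempty) {x y : X}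
    (h : ∀ z ∈ F, ‖y - z‖ < ‖x - z‖) : Metric.infDist y F < Metric.infDist x F := by
  obtain ⟨z, hz, hxz⟩ := hF.exists_infDist_eq_dist hne x
  rw [hxz, dist_eq_norm]
  exact (Metric.infDist_le_dist_of_mem hz).trans_lt (by rw [dist_eq_norm]; exact h z hz)

lemma infDist_sub_le (F : Set X) (x y : X) :
    Metric.infDist (x - y) F ≤ Metric.infDist x F + ‖y‖ := by
  have := Metric.infDist_le_infDist_add_dist (s := F) (x := x - y) (y := x)
  simpa [dist_eq_norm] using this

lemma exists_pos_forall_le_of_isCompact {Y : Type*} [TopologicalSpace Y] {K : Set Y}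
    (hK : IsCompact K) {f : Y → ℝ} (hf : Continuous f) (hpos : ∀ y ∈ K, 0 < f y) :
    ∃ δ > 0, ∀ y ∈ K, δ ≤ f y := by
  rcases K.eq_empty_or_nonempty with rfl | hne
  · exact ⟨1, one_pos, by simp⟩
  · obtain ⟨y, hy, hmin⟩ := hK.exists_isMinOn hne hf.continuousOn
    exact ⟨f y, hpos y hy, fun z hz => hmin hz⟩

variable {S : X → X} {F : Set X} {ξ : ℕ → X}

/-- On the bounded region at distance at least `ε / 2` from `F`, compactness turns the strict
decrease of the distance into a uniform `δ`; eventually `e n` consumes at most half of it. The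
decrease does not fade, so the weights can be constant. -/
lemma tendsto_infDist_of_perturbed [ProperSpace X] (hS : Continuous S) (hF : IsCompact F)
    (hne : F.Nonempty) (hlt : ∀ x ∉ F, ∀ z ∈ F, ‖S x - z‖ < ‖x - z‖)
    (hle : ∀ x, ∀ z ∈ F, ‖S x - z‖ ≤ ‖x - z‖) {e : ℕ → X} (he : Tendsto e atTop (𝓝 0))
    (hbdd : ∃ R, ∀ n, ‖ξ n‖ ≤ R) (hξ : ∀ n, ξ (n + 1) = S (ξ n) - e n) :
    Tendsto (fun n => Metric.infDist (ξ n) F) atTop (𝓝 0) := by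
  obtain ⟨R, hR⟩ := hbdd
  refine tendsto_zero_of_eventually_le_max_sub (lam := fun _ => 1)
    (fun n => Metric.infDist_nonneg) (fun _ => zero_le_one) ?_ fun ε hε => ?_
  · simpa using tendsto_natCast_atTop_atTop
  have hcont : Continuous fun x => Metric.infDist x F - Metric.infDist (S x) F :=
    (Metric.continuous_infDist_pt F).sub ((Metric.continuous_infDist_pt F).comp hS)
  have hK : IsCompact (Metric.closedBall (0 : X) R ∩ {x | ε / 2 ≤ Metric.infDist x F}) :=
    (isCompact_closedBall 0 R).inter_right
      (isClosed_le continuous_const (Metric.continuous_infDist_pt F))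
  obtain ⟨δ, hδ, hδ'⟩ := exists_pos_forall_le_of_isCompact hK hcont fun x hx => by
    refine sub_pos.2 (infDist_lt_infDist_of_norm_lt hF hne (hlt x fun hxF => ?_))
    have : ε / 2 ≤ Metric.infDist x F := hx.2
    rw [Metric.infDist_zero_of_mem hxF] at this
    linarith
  refine ⟨δ / 2, half_pos hδ, ?_⟩
  have hev : ∀ᶠ n in atTop, ‖e n‖ < min (δ / 2) (ε / 2) :=
    (tendsto_norm_zero.comp he).eventually_lt_const
      (lt_min (half_pos hδ) (half_pos hε))
  filter_upwards [hev] with n hn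
  have h1 := infDist_sub_le F (S (ξ n)) (e n)
  rw [← hξ] at h1
  by_cases hx : ε / 2 ≤ Metric.infDist (ξ n) F
  · have h2 := hδ' (ξ n) ⟨by simpa using hR n, hx⟩
    refine le_max_of_le_right ?_
    linarith [hn.trans_le (min_le_left _ _)]
  · have h2 := infDist_le_infDist_of_norm_le hF hne (hle (ξ n))
    refine le_max_of_le_left ?_
    linarith [hn.trans_le (min_le_right _ _)]

variable [InnerProductSpace ℝ X] {M : X → X} {lam : ℕ → ℝ}

/-- If `M` is cocoercive, a point of `F` that satisfies the variational inequality only against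
one solution is a solution. -/
lemma mem_solVI_of_cocoercive {c : ℝ} (hc : 0 < c)
    (hM : ∀ x y, c * ‖M x - M y‖ ^ 2 ≤ inner ℝ (M x - M y) (x - y)) {p q : X}
    (hp : p ∈ solVI F M) (hq : q ∈ F) (h : inner ℝ (M q) (q - p) ≤ 0) : q ∈ solVI F M := by
  have h1 := hM q p
  have h2 := hp.2 q hq
  rw [inner_sub_left] at h1
  -- The two inequalities along `q - p` have opposite signs, so cocoercivity forces `M q = M p`.
  have h3 : c * ‖M q - M p‖ ^ 2 ≤ 0 := by linarith
  have h4 : ‖M q - M p‖ = 0 := by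
    refine pow_eq_zero_iff two_ne_zero |>.1 (le_antisymm ?_ (sq_nonneg _))
    exact nonpos_of_mul_nonpos_right h3 hc
  have h5 : M q = M p := sub_eq_zero.1 (norm_eq_zero.1 h4)
  refine ⟨hq, fun y hy => ?_⟩
  have h6 := hp.2 y hy
  have e : y - q = (y - p) - (q - p) := by abel
  rw [e, inner_sub_right]
  rw [h5] at h ⊢
  linarith

lemma continuous_of_cocoercive {c : ℝ} (hc : 0 < c)
    (hM : ∀ x y, c * ‖M x - M y‖ ^ 2 ≤ inner ℝ (M x - M y) (x - y)) : Continuous M := by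
  refine (LipschitzWith.of_dist_le_mul (K := ⟨c⁻¹, by positivity⟩) fun x y => ?_).continuous
  have h : ‖c • (M x - M y)‖ ≤ ‖x - y‖ := norm_le_of_norm_sq_le_inner <| by
    rw [norm_smul, Real.norm_of_nonneg hc.le, real_inner_smul_left]
    refine le_trans (le_of_eq ?_) (mul_le_mul_of_nonneg_left (hM x y) hc.le)
    ring
  rw [norm_smul, Real.norm_of_nonneg hc.le] at h
  rw [dist_eq_norm, dist_eq_norm]
  exact (le_inv_mul_iff₀ hc).2 h

lemma isClosed_solVI (hM : Continuous M) (hF : IsClosed F) :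
    IsClosed (solVI F M) := by
  have : solVI F M = F ∩ ⋂ y ∈ F, {x | 0 ≤ inner ℝ (M x) (y - x)} := by
    ext x; simp [solVI]
  rw [this]
  refine hF.inter (isClosed_biInter fun y _ => ?_)
  exact isClosed_le continuous_const (by fun_prop)

/-- Convergence of the hybrid steepest descent method for a strictly quasi-nonexpansive operator
with bounded range and a cocoercive descent direction. -/
theorem tendsto_infDist_solVI [ProperSpace X] (hS : Continuous S) (hF : IsCompact F)
    (hlt : ∀ x ∉ F, ∀ z ∈ F, ‖S x - z‖ < ‖x - z‖)
    (hle : ∀ x, ∀ z ∈ F, ‖S x - z‖ ≤ ‖x - z‖) {R : ℝ} (hSR : ∀ x, ‖S x‖ ≤ R)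
    {c : ℝ} (hc : 0 < c)
    (hM : ∀ x y, c * ‖M x - M y‖ ^ 2 ≤ inner ℝ (M x - M y) (x - y))
    (hsol : (solVI F M).Nonempty) (hlam : ∀ n, 0 ≤ lam n) (hlam0 : Tendsto lam atTop (𝓝 0))
    (hsum : Tendsto (fun N => ∑ n ∈ Finset.range N, lam n) atTop atTop)
    (hξ : ∀ n, ξ (n + 1) = S (ξ n) - lam (n + 1) • M (S (ξ n))) :
    Tendsto (fun n => Metric.infDist (ξ n) (solVI F M)) atTop (𝓝 0) := by
  have hMc := continuous_of_cocoercive hc hM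
  have hΩF : solVI F M ⊆ F := fun x hx => hx.1
  have hne : F.Nonempty := hsol.mono hΩF
  have hΩ : IsCompact (solVI F M) := hF.of_isClosed_subset (isClosed_solVI hMc hF.isClosed) hΩF
  have hlam1 : Tendsto (fun n => lam (n + 1)) atTop (𝓝 0) := (tendsto_add_atTop_iff_nat 1).2 hlam0
  obtain ⟨C, hC⟩ := (isCompact_closedBall (0 : X) R).exists_bound_of_continuousOn hMc.continuousOn
  have hMS : ∀ x, ‖M (S x)‖ ≤ C := fun x => hC _ (by simpa using hSR x)
  have hC0 : 0 ≤ C := (norm_nonneg _).trans (hMS 0)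
  have he : Tendsto (fun n => lam (n + 1) • M (S (ξ n))) atTop (𝓝 0) := by
    refine squeeze_zero_norm (a := fun n => lam (n + 1) * C) (fun n => ?_) ?_
    · rw [norm_smul, Real.norm_of_nonneg (hlam _)]
      exact mul_le_mul_of_nonneg_left (hMS _) (hlam _)
    · simpa using hlam1.mul_const C
  have hbdd : ∃ R', ∀ n, ‖ξ n‖ ≤ R' := by
    obtain ⟨B, hB⟩ := (he.norm.bddAbove_range)
    refine ⟨max ‖ξ 0‖ (R + B), fun n => ?_⟩
    cases n with
    | zero => exact le_max_left _ _
    | succ n =>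
      refine le_max_of_le_right ?_
      rw [hξ]
      exact (norm_sub_le _ _).trans (add_le_add (hSR _) (hB ⟨n, rfl⟩))
  have hD := tendsto_infDist_of_perturbed hS hF hne hlt hle he hbdd hξ
  have hDS : Tendsto (fun n => Metric.infDist (S (ξ n)) F) atTop (𝓝 0) :=
    squeeze_zero (fun _ => Metric.infDist_nonneg)
      (fun n => infDist_le_infDist_of_norm_le hF hne (hle (ξ n))) hD
  suffices Tendsto (fun n => Metric.infDist (ξ n) (solVI F M) ^ 2) atTop (𝓝 0) by
    have h := this.sqrt
    simpa [Real.sqrt_sq Metric.infDist_nonneg] using h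
  refine tendsto_zero_of_eventually_le_max_sub (fun n => sq_nonneg _) hlam hsum fun ε hε => ?_
  -- A point within `s` of the solution set, moved by less than `s`, ends at squared distance at
  -- most `ε`.
  obtain ⟨s, hs, hsε⟩ : ∃ s > 0, (2 * s) ^ 2 = ε :=
    ⟨√ε / 2, by positivity, by rw [mul_div_cancel₀ _ two_ne_zero, Real.sq_sqrt hε.le]⟩
  have hK : IsCompact ((Metric.closedBall (0 : X) R ∩ {x | s ≤ Metric.infDist x (solVI F M)}) ×ˢ
      solVI F M) :=
    ((isCompact_closedBall 0 R).inter_right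
      (isClosed_le continuous_const (Metric.continuous_infDist_pt _))).prod hΩ
  -- Away from the solutions, a point either is quantitatively off `F` or has descent at least `δ`
  -- towards every solution. If both quantities were nonpositive, `mem_solVI_of_cocoercive` would
  -- make the point a solution.
  obtain ⟨δ, hδ, hδ'⟩ := exists_pos_forall_le_of_isCompact hK
    (f := fun w : X × X => max (inner ℝ (M w.1) (w.1 - w.2)) (Metric.infDist w.1 F))
    (by
      refine Continuous.max (by fun_prop) ?_
      exact (Metric.continuous_infDist_pt F).comp continuous_fst) (by
      rintro ⟨x, p⟩ ⟨⟨-, hx⟩, hp⟩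
      by_contra! hcon
      have h1 := (le_max_left _ _).trans hcon
      have h2 := (le_max_right _ _).trans hcon
      have hxF : x ∈ F := by
        rw [← hF.isClosed.closure_eq, Metric.mem_closure_iff_infDist_zero hne]
        exact le_antisymm h2 Metric.infDist_nonneg
      have hxs : s ≤ Metric.infDist x (solVI F M) := hx
      rw [Metric.infDist_zero_of_mem (mem_solVI_of_cocoercive hc hM hp hxF h1)] at hxs
      linarith)
  refine ⟨δ, hδ, ?_⟩
  have hev1 : ∀ᶠ n in atTop, Metric.infDist (S (ξ n)) F < δ := hDS.eventually_lt_const hδ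
  -- This bounds the quadratic term by `lam (n + 1) * δ`, half of the gain `2 * lam (n + 1) * δ`
  -- from the cross term.
  have hev2 : ∀ᶠ n in atTop, lam (n + 1) * C ^ 2 < δ := by
    refine Tendsto.eventually_lt_const hδ ?_
    simpa using hlam1.mul_const (C ^ 2)
  have hev3 : ∀ᶠ n in atTop, ‖lam (n + 1) • M (S (ξ n))‖ < s :=
    (tendsto_norm_zero.comp he).eventually_lt_const hs
  filter_upwards [hev1, hev2, hev3] with n hn1 hn2 hn3
  have hmono : Metric.infDist (S (ξ n)) (solVI F M) ≤ Metric.infDist (ξ n) (solVI F M) :=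
    infDist_le_infDist_of_norm_le hΩ hsol fun z hz => hle _ z (hΩF hz)
  by_cases hx : s ≤ Metric.infDist (S (ξ n)) (solVI F M)
  · refine le_max_of_le_right ?_
    obtain ⟨p, hp, hpd⟩ := hΩ.exists_infDist_eq_dist hsol (S (ξ n))
    have h1 : δ ≤ inner ℝ (M (S (ξ n))) (S (ξ n) - p) := by
      rcases le_max_iff.1 (hδ' (S (ξ n), p) ⟨⟨by simpa using hSR _, hx⟩, hp⟩) with h | h
      · exact h
      · exact absurd hn1 (not_lt.2 h)
    have h2 : Metric.infDist (ξ (n + 1)) (solVI F M) ^ 2 ≤ ‖ξ (n + 1) - p‖ ^ 2 := by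
      gcongr
      · exact Metric.infDist_nonneg
      · rw [← dist_eq_norm]; exact Metric.infDist_le_dist_of_mem hp
    have e : ξ (n + 1) - p = (S (ξ n) - p) - lam (n + 1) • M (S (ξ n)) := by
      rw [hξ]; abel
    have h3 : ‖S (ξ n) - p‖ ^ 2 ≤ Metric.infDist (ξ n) (solVI F M) ^ 2 := by
      rw [← dist_eq_norm, ← hpd]
      gcongr
      exact Metric.infDist_nonneg
    have h4 : ‖lam (n + 1) • M (S (ξ n))‖ ^ 2 ≤ lam (n + 1) * δ := by
      rw [norm_smul, Real.norm_of_nonneg (hlam _), mul_pow, sq, mul_assoc]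
      refine mul_le_mul_of_nonneg_left (le_trans ?_ hn2.le) (hlam _)
      exact mul_le_mul_of_nonneg_left (by gcongr; exact hMS _) (hlam _)
    have h5 := mul_le_mul_of_nonneg_left h1 (hlam (n + 1))
    rw [e, norm_sub_sq_real, inner_smul_right, real_inner_comm] at h2
    nlinarith
  · refine le_max_of_le_left ?_
    rw [← hsε]
    have h1 := infDist_sub_le (solVI F M) (S (ξ n)) (lam (n + 1) • M (S (ξ n)))
    rw [← hξ] at h1
    gcongr
    · exact Metric.infDist_nonneg
    · linarith

end HybridSteepestDescent

/-! ### The primal-dual operators of the game. -/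

section Games

variable {m : ℕ} {E : Type*}

@[simp]
lemma replaceAt_self (x : Profile m E) (i : Fin m) (z : E) : replaceAt x i z i = z := by
  simp [replaceAt]

lemma replaceAt_of_ne (x : Profile m E) {i j : Fin m} (h : j ≠ i) (z : E) :
    replaceAt x i z j = x j := by
  simp [replaceAt, h]

variable [NormedAddCommGroup E] [InnerProductSpace ℝ E]
variable {G : Type*} [NormedAddCommGroup G] [InnerProductSpace ℝ G]

lemma inner_replaceAt_sub_left (x w : Profile m E) (i : Fin m) (z : E) :
    inner ℝ (replaceAt x i z - x) w = inner ℝ (z - x i) (w i) := by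
  rw [PiLp.inner_apply, Finset.sum_eq_single i]
  · simp
  · intro j _ hj
    simp [replaceAt_of_ne x hj]
  · simp

namespace GNEP

variable (P : GNEP m E G)

lemma C_nonempty (i : Fin m) : (P.C i).Nonempty :=
  let ⟨x, hx⟩ := P.feasible_nonempty
  ⟨x i, hx.1 i⟩

lemma D_nonempty : P.D.Nonempty :=
  let ⟨x, hx⟩ := P.feasible_nonempty
  ⟨P.L x, hx.2⟩

lemma prodC_nonempty : P.prodC.Nonempty := P.feasible_nonempty.imp fun _ hx => hx.1

/-- The normal cone of a product of sets is the product of the normal cones. -/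
lemma mem_subdifferential_indicatorFn_prodC {x w : Profile m E} :
    w ∈ subdifferential (indicatorFn P.prodC) x ↔
      ∀ i, w i ∈ subdifferential (indicatorFn (P.C i)) (x i) := by
  rw [mem_subdifferential_indicatorFn P.prodC_nonempty]
  simp_rw [fun i => mem_subdifferential_indicatorFn (P.C_nonempty i) (x := x i) (u := w i)]
  constructor
  · rintro ⟨hx, h⟩ i
    refine ⟨hx i, fun z hz => ?_⟩
    rw [← inner_replaceAt_sub_left]
    refine h _ fun j => ?_
    by_cases hj : j = i
    · subst hj; simpa using hz
    · rw [replaceAt_of_ne x hj]; exact hx j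
  · refine fun h => ⟨fun i => (h i).1, fun y hy => ?_⟩
    rw [PiLp.inner_apply]
    exact Finset.sum_nonpos fun i _ => (h i).2 _ (hy i)

lemma mem_opB_iff [CompleteSpace G] {ξ η : PrimalDual m E G} :
    η ∈ P.opB ξ ↔ (ξ.fst ∈ P.prodC ∧ ∀ y ∈ P.prodC, inner ℝ (y - ξ.fst) η.fst ≤ 0) ∧
      η.snd ∈ P.D ∧ ∀ y ∈ P.D, inner ℝ (y - η.snd) ξ.snd ≤ 0 := by
  rw [← mem_subdifferential_indicatorFn P.prodC_nonempty,
    mem_subdifferential_indicatorFn_prodC,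
    ← mem_subdifferential_conjugate_indicatorFn P.D_nonempty P.D_closed P.D_convex]
  rfl

lemma isMonotoneOp_opB [CompleteSpace G] : IsMonotoneOp P.opB := by
  intro ξ ζ a ha b hb
  rw [mem_opB_iff] at ha hb
  have h1 := ha.1.2 _ hb.1.1
  have h2 := hb.1.2 _ ha.1.1
  have h3 := ha.2.2 _ hb.2.1
  have h4 := hb.2.2 _ ha.2.1
  rw [WithLp.prod_inner_apply]
  change 0 ≤ inner ℝ (a.fst - b.fst) (ξ.fst - ζ.fst) + inner ℝ (a.snd - b.snd) (ξ.snd - ζ.snd)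
  rw [real_inner_comm]
  simp only [inner_sub_left, inner_sub_right] at *
  linarith

/-- The resolvent is explicit: projections onto the `C i`, and by Moreau's decomposition `u - γ
P_D(u / γ)` in the dual variable. -/
lemma hasFullRange_opB [CompleteSpace E] [CompleteSpace G] {γ : ℝ} (hγ : 0 < γ) :
    HasFullRange γ P.opB := by
  intro ξ
  set p : Profile m E := WithLp.toLp 2 fun i => metricProj (P.C i) (ξ.fst i)
  have hp : ∀ i, p i = metricProj (P.C i) (ξ.fst i) := fun i => rfl
  set w : G := metricProj P.D (γ⁻¹ • ξ.snd) with hw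
  refine ⟨WithLp.toLp 2 (p, ξ.snd - γ • w), WithLp.toLp 2 (γ⁻¹ • (ξ.fst - p), w), ⟨?_, ?_⟩, ?_⟩
  · intro i
    obtain ⟨h1, h2⟩ := metricProj_spec (P.C_nonempty i) (P.C_closed i) (P.C_convex i) (ξ.fst i)
    rw [← hp] at h1 h2
    refine (mem_subdifferential_indicatorFn (P.C_nonempty i)).2 ⟨h1, fun y hy => ?_⟩
    change inner ℝ (y - p i) (γ⁻¹ • (ξ.fst i - p i)) ≤ 0
    have h3 := h2 y hy
    rw [← neg_sub, inner_neg_left, real_inner_comm] at h3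
    rw [inner_smul_right]
    exact mul_nonpos_of_nonneg_of_nonpos (by positivity) (by linarith)
  · obtain ⟨h1, h2⟩ := metricProj_spec P.D_nonempty P.D_closed P.D_convex (γ⁻¹ • ξ.snd)
    rw [← hw] at h1 h2
    refine (mem_subdifferential_conjugate_indicatorFn P.D_nonempty P.D_closed P.D_convex).2
      ⟨h1, fun y hy => ?_⟩
    change inner ℝ (y - w) (ξ.snd - γ • w) ≤ 0
    have h3 := h2 y hy
    have e : ξ.snd - γ • w = -(γ • (w - γ⁻¹ • ξ.snd)) := by
      rw [smul_sub, smul_inv_smul₀ hγ.ne', neg_sub]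
    rw [e, inner_neg_right, inner_smul_right, real_inner_comm]
    nlinarith
  · refine (WithLp.ofLp_injective 2) (Prod.ext ?_ ?_)
    · change ξ.fst = p + γ • γ⁻¹ • (ξ.fst - p)
      rw [smul_inv_smul₀ hγ.ne']; abel
    · change ξ.snd = (ξ.snd - γ • w) + γ • w
      abel

section Forward

variable [CompleteSpace E] [CompleteSpace G]

/-- The part of `A` built from `L` and its adjoint is skew, so its contribution cancels. -/
lemma inner_opA_sub_nonneg
    (hmono : ∀ x y, 0 ≤ inner ℝ (P.grad x - P.grad y) (x - y)) (ξ ζ : PrimalDual m E G) :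
    0 ≤ inner ℝ (P.opA ξ - P.opA ζ) (ξ - ζ) := by
  rw [WithLp.prod_inner_apply]
  change 0 ≤ inner ℝ ((P.grad ξ.fst + ContinuousLinearMap.adjoint P.L ξ.snd) -
      (P.grad ζ.fst + ContinuousLinearMap.adjoint P.L ζ.snd)) (ξ.fst - ζ.fst) +
    inner ℝ (-P.L ξ.fst - -P.L ζ.fst) (ξ.snd - ζ.snd)
  rw [add_sub_add_comm, inner_add_left, ← map_sub, ContinuousLinearMap.adjoint_inner_left,
    ← neg_sub', ← map_sub, inner_neg_left, real_inner_comm (ξ.snd - ζ.snd)]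
  linarith [hmono ξ.fst ζ.fst]

/-- The gradient part contributes `κ`. The skew part contributes `‖L‖` only once, because its two
components act on orthogonal factors. -/
lemma norm_opA_sub_le {κ : ℝ} (hκ : 0 ≤ κ)
    (hlip : ∀ x y, ‖P.grad x - P.grad y‖ ≤ κ * ‖x - y‖) (ξ ζ : PrimalDual m E G) :
    ‖P.opA ξ - P.opA ζ‖ ≤ (κ + ‖P.L‖) * ‖ξ - ζ‖ := by
  have e : P.opA ξ - P.opA ζ = WithLp.toLp 2 (P.grad ξ.fst - P.grad ζ.fst, (0 : G)) +
      WithLp.toLp 2 (ContinuousLinearMap.adjoint P.L (ξ.snd - ζ.snd), -P.L (ξ.fst - ζ.fst)) := by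
    refine (WithLp.ofLp_injective 2) (Prod.ext ?_ ?_)
    · change (P.grad ξ.fst + ContinuousLinearMap.adjoint P.L ξ.snd) -
        (P.grad ζ.fst + ContinuousLinearMap.adjoint P.L ζ.snd) = (P.grad ξ.fst - P.grad ζ.fst) +
          ContinuousLinearMap.adjoint P.L (ξ.snd - ζ.snd)
      rw [map_sub]; abel
    · change -P.L ξ.fst - -P.L ζ.fst = 0 + -P.L (ξ.fst - ζ.fst)
      rw [map_sub]; abel
  have hsq : ‖ξ - ζ‖ ^ 2 = ‖ξ.fst - ζ.fst‖ ^ 2 + ‖ξ.snd - ζ.snd‖ ^ 2 :=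
    WithLp.prod_norm_sq_eq_of_L2 _
  rw [e, add_mul]
  refine (norm_add_le _ _).trans (add_le_add ?_ ?_)
  · refine le_of_sq_le_sq ?_ (by positivity)
    rw [WithLp.prod_norm_sq_eq_of_L2]
    change ‖P.grad ξ.fst - P.grad ζ.fst‖ ^ 2 + ‖(0 : G)‖ ^ 2 ≤ _
    have h1 : ‖P.grad ξ.fst - P.grad ζ.fst‖ ^ 2 ≤ (κ * ‖ξ.fst - ζ.fst‖) ^ 2 := by
      gcongr
      exact hlip _ _
    rw [mul_pow] at h1
    rw [mul_pow, hsq, norm_zero]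
    nlinarith [mul_nonneg (sq_nonneg κ) (sq_nonneg ‖ξ.snd - ζ.snd‖)]
  · refine le_of_sq_le_sq ?_ (by positivity)
    rw [WithLp.prod_norm_sq_eq_of_L2]
    change ‖ContinuousLinearMap.adjoint P.L (ξ.snd - ζ.snd)‖ ^ 2 + ‖-P.L (ξ.fst - ζ.fst)‖ ^ 2 ≤ _
    have h1 : ‖ContinuousLinearMap.adjoint P.L (ξ.snd - ζ.snd)‖ ^ 2 ≤
        (‖P.L‖ * ‖ξ.snd - ζ.snd‖) ^ 2 := by
      gcongr
      refine (ContinuousLinearMap.le_opNorm _ _).trans_eq ?_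
      rw [LinearIsometryEquiv.norm_map]
    have h2 : ‖-P.L (ξ.fst - ζ.fst)‖ ^ 2 ≤ (‖P.L‖ * ‖ξ.fst - ζ.fst‖) ^ 2 := by
      rw [norm_neg]
      gcongr
      exact ContinuousLinearMap.le_opNorm _ _
    rw [mul_pow] at h1 h2
    rw [mul_pow, hsq]
    linarith

variable {P} {κ γ α : ℝ}

lemma continuous_opA (hκ : 0 ≤ κ) (hlip : ∀ x y, ‖P.grad x - P.grad y‖ ≤ κ * ‖x - y‖) :
    Continuous P.opA :=
  (LipschitzWith.of_dist_le_mul (K := ⟨κ + ‖P.L‖, by positivity⟩) fun x y => by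
    rw [dist_eq_norm, dist_eq_norm]; exact P.norm_opA_sub_le hκ hlip x y).continuous

lemma norm_smul_opA_sub_lt (hκ : 0 < κ)
    (hlip : ∀ x y, ‖P.grad x - P.grad y‖ ≤ κ * ‖x - y‖) (hγ : γ ∈ Ioo 0 (1 / (κ + ‖P.L‖)))
    {ξ ζ : PrimalDual m E G} (hne : ξ ≠ ζ) : ‖γ • (P.opA ξ - P.opA ζ)‖ < ‖ξ - ζ‖ := by
  have hβ : 0 < κ + ‖P.L‖ := by positivity
  have h1 := hγ.2
  rw [lt_div_iff₀ hβ] at h1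
  rw [norm_smul, Real.norm_of_nonneg hγ.1.le]
  have h2 := mul_le_mul_of_nonneg_left (P.norm_opA_sub_le hκ.le hlip ξ ζ) hγ.1.le
  have h3 : 0 < ‖ξ - ζ‖ := norm_pos_iff.2 (sub_ne_zero.2 hne)
  nlinarith

lemma continuous_opFBFavg (hκ : 0 ≤ κ)
    (hlip : ∀ x y, ‖P.grad x - P.grad y‖ ≤ κ * ‖x - y‖) (hγ : 0 < γ) :
    Continuous (P.opFBFavg γ α) := by
  have hA := continuous_opA hκ hlip
  have hJ : Continuous (P.opFB γ) :=
    (continuous_resolvent P.isMonotoneOp_opB (P.hasFullRange_opB hγ) hγ).comp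
      (continuous_id.sub (hA.const_smul γ))
  have hT : Continuous (P.opFBF γ) :=
    (hJ.sub ((hA.comp hJ).const_smul γ)).add (hA.const_smul γ)
  exact (continuous_const_smul (1 - α)).add (hT.const_smul α)

/-- The fixed points of the averaged operator are the zeros of `A + B`. -/
lemma mem_fixedPoints_opFBFavg_iff (hκ : 0 < κ)
    (hlip : ∀ x y, ‖P.grad x - P.grad y‖ ≤ κ * ‖x - y‖) (hγ : γ ∈ Ioo 0 (1 / (κ + ‖P.L‖)))
    (hα : 0 < α) {ξ : PrimalDual m E G} :
    ξ ∈ Function.fixedPoints (P.opFBFavg γ α) ↔ -P.opA ξ ∈ P.opB ξ := by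
  rw [← resolvent_forward_eq_self_iff P.isMonotoneOp_opB (P.hasFullRange_opB hγ.1) hγ.1]
  change (1 - α) • ξ + α • ((P.opFB γ ξ - γ • P.opA (P.opFB γ ξ)) + γ • P.opA ξ) = ξ ↔
    P.opFB γ ξ = ξ
  constructor
  · intro h
    -- A fixed point satisfies `ξ - η = γ (A ξ - A η)` with `η = opFB γ ξ`; as `γ A` strictly
    -- shrinks distances between distinct points, `η = ξ`.
    have h1 : α • ((ξ - P.opFB γ ξ) - γ • (P.opA ξ - P.opA (P.opFB γ ξ))) = 0 := by
      calc _ = ξ - ((1 - α) • ξ +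
            α • ((P.opFB γ ξ - γ • P.opA (P.opFB γ ξ)) + γ • P.opA ξ)) := by module
        _ = 0 := by rw [h, sub_self]
    have h2 := sub_eq_zero.1 ((smul_eq_zero.1 h1).resolve_left hα.ne')
    by_contra hne
    have h3 := norm_smul_opA_sub_lt hκ hlip hγ (Ne.symm hne)
    rw [← h2] at h3
    exact lt_irrefl _ h3
  · intro h
    rw [h]
    module

/-- Off the fixed points `ξ ≠ opFB γ ξ`, so in Tseng's estimate the gain strictly exceeds the error;
averaging keeps the strict inequality since `α > 0`. -/
lemma norm_opFBFavg_sub_lt (hκ : 0 < κ)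
    (hlip : ∀ x y, ‖P.grad x - P.grad y‖ ≤ κ * ‖x - y‖)
    (hmono : ∀ x y, 0 ≤ inner ℝ (P.grad x - P.grad y) (x - y))
    (hγ : γ ∈ Ioo 0 (1 / (κ + ‖P.L‖))) (hα : α ∈ Ioo (0 : ℝ) 1) {ξ z : PrimalDual m E G}
    (hξ : ξ ∉ Function.fixedPoints (P.opFBFavg γ α))
    (hz : z ∈ Function.fixedPoints (P.opFBFavg γ α)) :
    ‖P.opFBFavg γ α ξ - z‖ < ‖ξ - z‖ := by
  rw [mem_fixedPoints_opFBFavg_iff hκ hlip hγ hα.1] at hz hξ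
  have hne : ξ ≠ P.opFB γ ξ := fun h => hξ <|
    (resolvent_forward_eq_self_iff P.isMonotoneOp_opB (P.hasFullRange_opB hγ.1) hγ.1).1 h.symm
  have h1 : ‖P.opFBF γ ξ - z‖ ^ 2 ≤ _ :=
    norm_fbf_sub_sq_le P.isMonotoneOp_opB (P.hasFullRange_opB hγ.1) hγ.1
      (P.inner_opA_sub_nonneg hmono) rfl hz
  have h2 := norm_smul_opA_sub_lt hκ hlip hγ hne
  have h3 : ‖γ • (P.opA ξ - P.opA (P.opFB γ ξ))‖ ^ 2 < ‖ξ - P.opFB γ ξ‖ ^ 2 := by gcongr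
  have h4 : ‖P.opFBF γ ξ - z‖ < ‖ξ - z‖ := by
    refine lt_of_pow_lt_pow_left₀ 2 (norm_nonneg _) (h1.trans_lt ?_)
    change _ - ‖ξ - P.opFB γ ξ‖ ^ 2 + ‖γ • (P.opA ξ - P.opA (P.opFB γ ξ))‖ ^ 2 < _
    linarith
  have e : P.opFBFavg γ α ξ - z = (1 - α) • (ξ - z) + α • (P.opFBF γ ξ - z) := by
    unfold opFBFavg; module
  rw [e]
  refine (norm_add_le _ _).trans_lt ?_
  rw [norm_smul, norm_smul, Real.norm_of_nonneg hα.1.le,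
    Real.norm_of_nonneg (sub_nonneg.2 hα.2.le)]
  nlinarith [hα.1]

/-- The primal parts of the zeros of `A + B` are variational equilibria. -/
lemma fst_mem_vGNE {ξ : PrimalDual m E G} (h : -P.opA ξ ∈ P.opB ξ) : ξ.fst ∈ P.vGNE := by
  rw [mem_opB_iff] at h
  obtain ⟨⟨h1, h2⟩, h3, h4⟩ := h
  have e1 : (-P.opA ξ).fst = -(P.grad ξ.fst + ContinuousLinearMap.adjoint P.L ξ.snd) := rfl
  have e2 : (-P.opA ξ).snd = P.L ξ.fst := neg_neg _
  rw [e1] at h2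
  rw [e2] at h3 h4
  refine ⟨⟨h1, h3⟩, fun y hy => ?_⟩
  have h5 := h2 y hy.1
  -- The multiplier is normal to `D` at `L x`, which controls the sign of the term `⟨u, L (y - x)⟩`
  -- left in `h5`.
  have h6 := h4 _ hy.2
  rw [inner_neg_right, inner_add_right, ContinuousLinearMap.adjoint_inner_right, map_sub] at h5
  rw [real_inner_comm]
  linarith

/-- Under the subdifferential rule, every variational equilibrium has a multiplier. -/
lemma exists_multiplier (hrule : P.SubdifferentialRule) {x : Profile m E} (hx : x ∈ P.vGNE) :
    ∃ ξ : PrimalDual m E G, ξ.fst = x ∧ -P.opA ξ ∈ P.opB ξ := by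
  have hfun : (fun y => indicatorFn P.prodC y + indicatorFn P.D (P.L y)) =
      indicatorFn P.feasible := by
    funext y
    by_cases h1 : y ∈ P.prodC <;> by_cases h2 : P.L y ∈ P.D <;>
      simp [indicatorFn, feasible, h1, h2]
  have hsub : -P.grad x ∈ subdifferential (indicatorFn P.feasible) x := by
    rw [mem_subdifferential_indicatorFn ⟨x, hx.1⟩]
    refine ⟨hx.1, fun y hy => ?_⟩
    rw [inner_neg_right, real_inner_comm]
    linarith [hx.2 y hy]
  -- The rule splits `-grad x` as `c + L* u` with `c` normal to the product set and `u` normal to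
  -- `D` at `L x`; this `u` is the multiplier.
  rw [← hfun, hrule x] at hsub
  obtain ⟨c, hc, _, ⟨u, hu, rfl⟩, hcu⟩ := hsub
  rw [mem_subdifferential_indicatorFn P.prodC_nonempty] at hc
  rw [mem_subdifferential_indicatorFn P.D_nonempty] at hu
  refine ⟨WithLp.toLp 2 (x, u), rfl, P.mem_opB_iff.2 ?_⟩
  have e1 : (-P.opA (WithLp.toLp 2 (x, u))).fst = c := by
    change -(P.grad x + ContinuousLinearMap.adjoint P.L u) = c
    rw [neg_add, ← hcu]
    simp
  have e2 : (-P.opA (WithLp.toLp 2 (x, u))).snd = P.L x := neg_neg _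
  rw [e1, e2]
  exact ⟨hc, hu⟩

end Forward

end GNEP

/-! ### The cyclic pseudo-gradient and cycles. -/

section Cycles

variable [NeZero m]

/-- This is where `2 ≤ m` enters: the predecessor's strategy is held fixed when player `i` varies.
-/
lemma sub_one_ne_self (hm : 2 ≤ m) (i : Fin m) : i - 1 ≠ i := by
  obtain ⟨k, rfl⟩ := Nat.exists_eq_add_of_le' hm
  simp

variable [CompleteSpace E]

lemma gradient_half_norm_sub_sq (a z : E) :
    gradient (fun z : E => (1 / 2 : ℝ) * ‖z - a‖ ^ 2) z = z - a := by
  refine HasGradientAt.gradient ?_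
  rw [hasGradientAt_iff_hasFDerivAt]
  have h := (((hasFDerivAt_id (𝕜 := ℝ) z).sub_const a).norm_sq).const_mul (1 / 2 : ℝ)
  refine h.congr_fderiv ?_
  ext w
  simp

lemma cycleGrad_apply (hm : 2 ≤ m) (x : Profile m E) (i : Fin m) :
    cycleGrad x i = x i - x (i - 1) := by
  change gradient (fun z : E => cycleCost i (replaceAt x i z)) (x i) = _
  simp only [cycleCost, replaceAt_self, replaceAt_of_ne x (sub_one_ne_self hm i)]
  exact gradient_half_norm_sub_sq _ _

/-- With `d = x - y` and `R` the cyclic shift, `‖R d‖ = ‖d‖` gives `‖d - R d‖² = 2 ⟨d - R d, d⟩`. -/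
lemma cycleGrad_cocoercive (hm : 2 ≤ m) (x y : Profile m E) :
    1 / 2 * ‖cycleGrad x - cycleGrad y‖ ^ 2 = inner ℝ (cycleGrad x - cycleGrad y) (x - y) := by
  have hd : ∀ i, (cycleGrad x - cycleGrad y) i = (x - y) i - (x - y) (i - 1) := fun i => by
    rw [PiLp.sub_apply, cycleGrad_apply hm, cycleGrad_apply hm, PiLp.sub_apply, PiLp.sub_apply]
    abel
  have hshift : ∑ i, ‖(x - y) (i - 1)‖ ^ 2 = ∑ i, ‖(x - y) i‖ ^ 2 :=
    (Equiv.subRight (1 : Fin m)).sum_comp fun i => ‖(x - y) i‖ ^ 2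
  rw [PiLp.norm_sq_eq_of_L2, PiLp.inner_apply]
  simp_rw [hd, norm_sub_sq_real, inner_sub_left, real_inner_self_eq_norm_sq]
  rw [Finset.sum_add_distrib, Finset.sum_sub_distrib, Finset.sum_sub_distrib, hshift,
    ← Finset.mul_sum]
  simp_rw [real_inner_comm]
  ring

lemma cycleGradExt_cocoercive (hm : 2 ≤ m) (ξ ζ : PrimalDual m E G) :
    1 / 2 * ‖cycleGradExt ξ - cycleGradExt ζ‖ ^ 2 ≤
      inner ℝ (cycleGradExt ξ - cycleGradExt ζ) (ξ - ζ) := by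
  rw [WithLp.prod_norm_sq_eq_of_L2, WithLp.prod_inner_apply]
  change 1 / 2 * (‖cycleGrad ξ.fst - cycleGrad ζ.fst‖ ^ 2 + ‖(0 : G) - 0‖ ^ 2) ≤
    inner ℝ (cycleGrad ξ.fst - cycleGrad ζ.fst) (ξ.fst - ζ.fst) +
      inner ℝ ((0 : G) - 0) (ξ.snd - ζ.snd)
  simp [← cycleGrad_cocoercive hm]

/-- Every solution of the upper-level variational inequality is a cycle. -/
lemma upperCycleVGNE_subset_cyclesOver (hm : 2 ≤ m) (V : Set (Profile m E)) :
    upperCycleVGNE V ⊆ cyclesOver V := by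
  intro x hx
  refine ⟨hx.1, fun i => (metricProj_eq_of_inner_nonneg ?_ fun z hz => ?_).symm⟩
  · have : replaceAt x i (x i) = x := by simp [replaceAt]
    change replaceAt x i (x i) ∈ V
    rw [this]
    exact hx.1
  -- A deviation of player `i` alone isolates the `i`-th term of the inequality, which characterizes
  -- the projection onto the slice.
  · have h := hx.2 _ hz
    rw [real_inner_comm, inner_replaceAt_sub_left, cycleGrad_apply hm, real_inner_comm] at h
    exact h

end Cycles

end Games

end CycleSelection

/-! ### Assembly of the convergence theorem. -/

theorem mainTheorem4
    {m : ℕ} [NeZero m] (hm : 2 ≤ m)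
    {E : Type*} [NormedAddCommGroup E] [InnerProductSpace ℝ E] [CompleteSpace E]
    [FiniteDimensional ℝ E]
    {G : Type*} [NormedAddCommGroup G] [InnerProductSpace ℝ G] [CompleteSpace G]
    [FiniteDimensional ℝ G]
    (P : CycleSelection.GNEP m E G)
    (hVcyc : (CycleSelection.upperCycleVGNE P.vGNE).Nonempty)
    (hrule : P.SubdifferentialRule)
    (κ : ℝ) (hκ : 0 < κ)
    (hlip : ∀ x y : CycleSelection.Profile m E, ‖P.grad x - P.grad y‖ ≤ κ * ‖x - y‖)
    (hmono : ∀ x y : CycleSelection.Profile m E, 0 ≤ inner ℝ (P.grad x - P.grad y) (x - y))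
    (γ : ℝ) (hγ : γ ∈ Set.Ioo 0 (1 / (κ + ‖P.L‖)))
    (α : ℝ) (hα : α ∈ Set.Ioo (0 : ℝ) 1)
    (hbdd : Bornology.IsBounded (Function.fixedPoints (P.opFBFavg γ α)))
    (r : ℝ) (hr : 0 < r)
    (hFix : Function.fixedPoints (P.opFBFavg γ α) ⊆
      Metric.closedBall (0 : CycleSelection.PrimalDual m E G) r)
    (lam : ℕ → ℝ) (hlam_nonneg : ∀ n, 0 ≤ lam n)
    (hlam_lim : Filter.Tendsto lam Filter.atTop (nhds 0))
    (hlam_sum : Filter.Tendsto (fun N => ∑ n ∈ Finset.range N, lam n)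
      Filter.atTop Filter.atTop)
    (ξ : ℕ → CycleSelection.PrimalDual m E G)
    (hξ : ∀ n, ξ (n + 1) =
      CycleSelection.metricProj (Metric.closedBall 0 r) (P.opFBFavg γ α (ξ n)) -
        lam (n + 1) • CycleSelection.cycleGradExt
          (CycleSelection.metricProj (Metric.closedBall 0 r) (P.opFBFavg γ α (ξ n)))) :
    Filter.Tendsto
        (fun n => Metric.infDist (ξ n).fst (CycleSelection.upperCycleVGNE P.vGNE))
        Filter.atTop (nhds 0) ∧
      CycleSelection.upperCycleVGNE P.vGNE ⊆ CycleSelection.cyclesOver P.vGNE := by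
  open CycleSelection in
  refine ⟨?_, upperCycleVGNE_subset_cyclesOver hm _⟩
  set F := Function.fixedPoints (P.opFBFavg γ α) with hFdef
  have hmem : ∀ {ζ : PrimalDual m E G}, ζ ∈ F ↔ -P.opA ζ ∈ P.opB ζ :=
    GNEP.mem_fixedPoints_opFBFavg_iff hκ hlip hγ hα.1
  have hT : Continuous (P.opFBFavg γ α) := GNEP.continuous_opFBFavg hκ.le hlip hγ.1
  have hFcpt : IsCompact F :=
    Metric.isCompact_of_isClosed_isBounded (isClosed_fixedPoints hT) hbdd
  have hball : (Metric.closedBall (0 : PrimalDual m E G) r).Nonempty :=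
    Metric.nonempty_closedBall.2 hr.le
  have hproj := norm_metricProj_sub_metricProj_le hball Metric.isClosed_closedBall
    (convex_closedBall (0 : PrimalDual m E G) r)
  have hS : Continuous fun ζ => metricProj (Metric.closedBall 0 r) (P.opFBFavg γ α ζ) :=
    (continuous_metricProj hball Metric.isClosed_closedBall (convex_closedBall _ r)).comp hT
  have hSle : ∀ ζ, ∀ z ∈ F, ‖metricProj (Metric.closedBall 0 r) (P.opFBFavg γ α ζ) - z‖ ≤
      ‖P.opFBFavg γ α ζ - z‖ := fun ζ z hz => by
    have h := hproj (P.opFBFavg γ α ζ) z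
    rwa [metricProj_of_mem (hFix hz)] at h
  have hlt : ∀ ζ ∉ F, ∀ z ∈ F,
      ‖metricProj (Metric.closedBall 0 r) (P.opFBFavg γ α ζ) - z‖ < ‖ζ - z‖ := fun ζ hζ z hz =>
    (hSle ζ z hz).trans_lt (GNEP.norm_opFBFavg_sub_lt hκ hlip hmono hγ hα hζ hz)
  have hle : ∀ ζ, ∀ z ∈ F,
      ‖metricProj (Metric.closedBall 0 r) (P.opFBFavg γ α ζ) - z‖ ≤ ‖ζ - z‖ := fun ζ z hz => by
    by_cases hζ : ζ ∈ F
    · have h := hSle ζ z hz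
      rwa [show P.opFBFavg γ α ζ = ζ from hζ] at h ⊢
    · exact (hlt ζ hζ z hz).le
  have hSR : ∀ ζ, ‖metricProj (Metric.closedBall 0 r) (P.opFBFavg γ α ζ)‖ ≤ r := fun ζ => by
    simpa using (metricProj_spec hball Metric.isClosed_closedBall
      (convex_closedBall (0 : PrimalDual m E G) r) (P.opFBFavg γ α ζ)).1
  have hinner : ∀ ζ η : PrimalDual m E G,
      inner ℝ (cycleGradExt ζ) (η - ζ) = inner ℝ (cycleGrad ζ.fst) (η.fst - ζ.fst) := by
    intro ζ η
    rw [WithLp.prod_inner_apply]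
    change inner ℝ (cycleGrad ζ.fst) (η.fst - ζ.fst) + inner ℝ (0 : G) (η.snd - ζ.snd) = _
    rw [inner_zero_left, add_zero]
  -- Every competitor in `vGNE` must be lifted to `F` by a multiplier; for `hsol` only the given
  -- solution is lifted.
  have hfst : ∀ ζ ∈ solVI F cycleGradExt, ζ.fst ∈ upperCycleVGNE P.vGNE := by
    refine fun ζ hζ => ⟨GNEP.fst_mem_vGNE (hmem.1 hζ.1), fun y hy => ?_⟩
    obtain ⟨η, rfl, hη⟩ := GNEP.exists_multiplier hrule hy
    rw [← hinner]
    exact hζ.2 η (hmem.2 hη)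
  have hsol : (solVI F cycleGradExt).Nonempty := by
    obtain ⟨x, hx⟩ := hVcyc
    obtain ⟨ζ, rfl, hζ⟩ := GNEP.exists_multiplier hrule hx.1
    refine ⟨ζ, hmem.2 hζ, fun η hη => ?_⟩
    rw [hinner]
    exact hx.2 _ (GNEP.fst_mem_vGNE (hmem.1 hη))
  have hlim := tendsto_infDist_solVI hS hFcpt hlt hle hSR one_half_pos
    (cycleGradExt_cocoercive hm) hsol hlam_nonneg hlam_lim hlam_sum hξ
  -- The primal projection is nonexpansive and sends lifted solutions to upper-level solutions, so
  -- it does not increase the distance.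
  refine squeeze_zero (fun _ => Metric.infDist_nonneg) (fun n => ?_) hlim
  refine (Metric.le_infDist hsol).2 fun ζ hζ => ?_
  refine (Metric.infDist_le_dist_of_mem (hfst ζ hζ)).trans ?_
  rw [dist_eq_norm, dist_eq_norm]
  refine le_of_sq_le_sq ?_ (norm_nonneg _)
  rw [WithLp.prod_norm_sq_eq_of_L2 (ξ n - ζ)]
  exact le_add_of_nonneg_right (sq_nonneg _)
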